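/- Let $R=\mathbb{F}_2[[x,y,z]]$, let \[ T=\begin{pmatrix} 0&y+z&z&z+y^2&z\\ y+z&0&x&x+y+z&x+y+z+z^2\\ z&x&0&z&x+z\\ z+y^2&x+y+z&z&0&x^2\\ z&x+y+z+z^2&x+z&x^2&0 \end{pmatrix}, \] and let $I$ be the ideal of $R$ generated by the five submaximal pfaffians $\mathrm{pf}_i(T)$, $i=1,\dots,5$, where $\mathrm{pf}_i(T)$ is the pfaffian of the $4\times 4$ matrix obtained from $T$ by removing the $i$-th row and the $i$-th column. Then $I$ is a Gorenstein ideal (that is, $R/I$ is a Gorenstein local ring) of grade $3$ (that is, the supremum of the lengths of $R$-regular sequences contained in $I$ is $3$), and $I$ is minimally generated by five elements (that is, the minimal number of generators of $I$ is $5$). -/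

import Mathlib

/-- The pfaffian of a square matrix (to be used for alternating matrices, i.e. skew-symmetric
matrices with zeros on the diagonal), by expansion along the first row:
`pf A = ∑ j, (-1) ^ j * A 0 (j + 1) * pf (A with rows and columns 0 and j + 1 removed)`.
The pfaffian of the empty matrix is `1` and that of a `1 × 1` matrix is `0`. -/
def pfaffian {R : Type*} [CommRing R] : {n : ℕ} → Matrix (Fin n) (Fin n) R → R
  | 0, _ => 1
  | 1, _ => 0
  | n + 2, A => ∑ j : Fin (n + 1), (-1) ^ (j : ℕ) * A 0 j.succ *
      pfaffian (A.submatrix (fun i => (j.succAbove i).succ) (fun i => (j.succAbove i).succ))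

/-- The `i`-th submaximal pfaffian: the pfaffian of the submatrix obtained by removing the row and
the column in position `i`. -/
def submaximalPfaffian {R : Type*} [CommRing R] {n : ℕ}
    (A : Matrix (Fin (n + 1)) (Fin (n + 1)) R) (i : Fin (n + 1)) : R :=
  pfaffian (A.submatrix i.succAbove i.succAbove)

/-- The grade of an ideal `I` of `R`: the supremum of the lengths of the `R`-regular sequences
contained in `I`. For `I ≠ R` every weakly regular sequence in `I` is regular; for `I = R` one
gets the usual convention `grade R = ∞`. -/
noncomputable def idealGrade {R : Type*} [CommRing R] (I : Ideal R) : ℕ∞ :=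
  ⨆ (rs : List R) (_ : ∀ r ∈ rs, r ∈ I) (_ : RingTheory.Sequence.IsWeaklyRegular R rs),
    (rs.length : ℕ∞)

/-- A Gorenstein local ring: a Noetherian local ring of finite injective dimension as a module
over itself. -/
structure IsGorensteinLocalRing (A : Type*) [CommRing A] : Prop where
  isNoetherianRing : IsNoetherianRing A
  isLocalRing : IsLocalRing A
  finite_injectiveDimension :
    ∃ d : ℕ, CategoryTheory.HasInjectiveDimensionLE (ModuleCat.of A A) d

/-- A Gorenstein ideal of a (regular) local ring: an ideal whose quotient ring is Gorenstein. -/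
def IsGorensteinIdeal {R : Type*} [CommRing R] (I : Ideal R) : Prop :=
  IsGorensteinLocalRing (R ⧸ I)

/-- The ring `𝔽₂⟦x, y, z⟧`. -/
abbrev F2xyz : Type := MvPowerSeries (Fin 3) (ZMod 2)

/-- The explicit `5 × 5` skew-symmetric matrix `T` over `𝔽₂⟦x, y, z⟧`. -/
noncomputable def matrixT : Matrix (Fin 5) (Fin 5) F2xyz :=
  let x : F2xyz := MvPowerSeries.X 0
  let y : F2xyz := MvPowerSeries.X 1
  let z : F2xyz := MvPowerSeries.X 2
  !![0,       y + z,             z,     z + y ^ 2, z;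
     y + z,   0,                 x,     x + y + z, x + y + z + z ^ 2;
     z,       x,                 0,     z,         x + z;
     z + y ^ 2, x + y + z,       z,     0,         x ^ 2;
     z,       x + y + z + z ^ 2, x + z, x ^ 2,     0]

/-- The ideal `I` generated by the five submaximal pfaffians of `T`. -/
noncomputable def idealI : Ideal F2xyz :=
  Ideal.span (Set.range (submaximalPfaffian matrixT))

/-! Macaulay duality makes everything explicit. In characteristic two, `I` has the simpler
generators `simpleGenerators`. It is exactly the set of `r` such that `dualForm` vanishes on all
multiples of `r` (`mem_idealI_iff`). One inclusion is checked on generators; for the other, 13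
monomials span `R/I` and their pairing under `dualForm` is nondegenerate. So `R/I` is a
finite-dimensional algebra with a nondegenerate form, hence self-injective, hence Gorenstein of
injective dimension 0. The grade is at most `dim R ≤ 3`, and `I` contains a regular sequence of
powers of the variables. Five generators are needed because `generatorForms` maps `I` onto `𝔽₂⁵`
while killing `𝔪I`. -/

/-! ### Linear forms, self-injectivity and numbers of generators -/

/-- A finite-dimensional commutative algebra with a linear form whose kernel contains no nonzero
ideal is self-injective. -/
theorem Module.Baer.of_linearForm {k A : Type*} [Field k] [CommRing A] [Algebra k A]
    [FiniteDimensional k A] (φ : A →ₗ[k] k) (h : ∀ a, (∀ b, φ (b * a) = 0) → a = 0) :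
    Module.Baer A A := by
  intro J f
  -- Extend `φ ∘ f` from `J` to `A`; nondegeneracy writes the extension as `φ (c * ·)`, and
  -- multiplication by `c` then extends `f`.
  obtain ⟨ψ, hψ⟩ := LinearMap.exists_extend (p := J.restrictScalars k)
    (φ ∘ₗ f.restrictScalars k)
  let B : A →ₗ[k] Module.Dual k A := LinearMap.compr₂ (LinearMap.mul k A) φ
  have hB : Function.Injective B := by
    rw [injective_iff_map_eq_zero]
    intro a ha
    refine h a fun b => ?_
    rw [mul_comm]
    exact LinearMap.congr_fun ha b
  have hB' : Function.Surjective B :=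
    (LinearMap.injective_iff_surjective_of_finrank_eq_finrank
      Subspace.dual_finrank_eq.symm).1 hB
  obtain ⟨c, rfl⟩ := hB' ψ
  have hc (x : A) (hx : x ∈ J) : φ (c * x) = φ (f ⟨x, hx⟩) :=
    LinearMap.congr_fun hψ ⟨x, hx⟩
  refine ⟨LinearMap.mulLeft A c, fun x hx => sub_eq_zero.1 (h _ fun b => ?_)⟩
  have h1 := hc (b * x) (J.mul_mem_left b hx)
  have h2 : f ⟨b * x, J.mul_mem_left b hx⟩ = b * f ⟨x, hx⟩ := f.map_smul b ⟨x, hx⟩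
  rw [h2] at h1
  rw [mul_sub, map_sub, ← h1, sub_eq_zero, LinearMap.mulLeft_apply]
  congr 1
  ring

/-- A linear form vanishing on all multiples of the generators vanishes on the ideal. -/
theorem Ideal.map_eq_zero_of_mem_span {R V : Type*} [CommRing R] [AddCommGroup V]
    {F : Type*} [FunLike F R V] [AddMonoidHomClass F R V] (φ : F) {G : Set R}
    (h : ∀ g ∈ G, ∀ a, φ (a * g) = 0) {r : R} (hr : r ∈ Ideal.span G) : φ r = 0 := by
  suffices ∀ a, φ (a * r) = 0 by simpa using this 1
  induction hr using Submodule.span_induction with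
  | mem g hg => exact h g hg
  | zero => simp
  | add x y _ _ hx hy => intro a; rw [mul_add, map_add, hx, hy, add_zero]
  | smul b x _ hx => intro a; rw [smul_eq_mul, ← mul_assoc, hx]

/-- Reduces to generators the claim that `L` kills `ker ε · I`, that is, that `L` on `I` factors
through `I / (ker ε) I`. -/
theorem Ideal.map_mul_eq_smul_of_mem_span {k R V : Type*} [CommRing k] [CommRing R]
    [AddCommGroup V] [Module k V] {F : Type*} [FunLike F R V] [AddMonoidHomClass F R V]
    (ε : R →+* k) (L : F) {G : Set R} (h : ∀ g ∈ G, ∀ a, L (a * g) = ε a • L g)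
    {r : R} (hr : r ∈ Ideal.span G) : ∀ a, L (a * r) = ε a • L r := by
  induction hr using Submodule.span_induction with
  | mem g hg => exact h g hg
  | zero => simp
  | add x y _ _ hx hy => intro a; rw [mul_add, map_add, hx, hy, map_add, smul_add]
  | smul b x _ hx =>
    intro a
    rw [smul_eq_mul, ← mul_assoc, hx, hx, map_mul, mul_smul]

/-- If `R` acts on the image of an ideal under a surjective linear map through a character, then
the dimension of the image bounds the number of generators from below. -/
theorem Ideal.rank_le_spanRank_of_character {k R V : Type} [Field k] [CommRing R] [Algebra k R]
    [AddCommGroup V] [Module k V] (ε : R → k) (I : Ideal R) (L : R →ₗ[k] V)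
    (hL : ∀ r ∈ I, ∀ a, L (a * r) = ε a • L r)
    (hI : (I.restrictScalars k).map L = ⊤) : Module.rank k V ≤ Submodule.spanRank I := by
  obtain ⟨s, hs, hsI⟩ := Submodule.exists_span_set_card_eq_spanRank I
  have key : ∀ r ∈ Submodule.span R s, L r ∈ Submodule.span k (L '' s) := by
    intro r hr
    induction hr using Submodule.span_induction with
    | mem g hg => exact Submodule.subset_span ⟨g, hg, rfl⟩
    | zero => simp
    | add x y _ _ hx hy => rw [map_add]; exact add_mem hx hy
    | smul b x hx hx' =>
      rw [smul_eq_mul, hL x (hsI ▸ hx)]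
      exact Submodule.smul_mem _ _ hx'
  have htop : Submodule.span k (L '' s) = ⊤ := by
    rw [eq_top_iff, ← hI]
    rintro _ ⟨r, hr, rfl⟩
    exact key r (hsI ▸ hr)
  calc Module.rank k V = Module.rank k (⊤ : Submodule k V) := (rank_top k V).symm
    _ = Module.rank k (Submodule.span k (L '' s)) := by rw [htop]
    _ ≤ Cardinal.mk (L '' s) := rank_span_le _
    _ ≤ Cardinal.mk s := Cardinal.mk_image_le
    _ = _ := hs

/-! ### Coefficients of power series -/

namespace MvPowerSeries

variable {σ k : Type*} [CommRing k]

/-- Division with remainder by a power of a variable. -/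
theorem exists_eq_add_X_pow_mul (s : σ) (m : ℕ) (f : MvPowerSeries σ k) :
    ∃ g h, f = g + X s ^ m * h ∧
      ∀ n, coeff n g = if n s < m then coeff n f else 0 := by
  let g : MvPowerSeries σ k := fun n => if n s < m then coeff n f else 0
  have hg : ∀ n, coeff n g = if n s < m then coeff n f else 0 := fun n => rfl
  obtain ⟨h, hh⟩ : X s ^ m ∣ f - g := by
    rw [X_pow_dvd_iff]
    intro n hn
    rw [map_sub, hg, if_pos hn, sub_self]
  exact ⟨g, h, by rw [← hh]; ring, hg⟩

/-- A power series in three variables is its constant term plus multiples of the variables. -/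
theorem exists_eq_C_add_X_mul (f : MvPowerSeries (Fin 3) k) :
    ∃ a b c, f = C (constantCoeff f) + X 0 * a + X 1 * b + X 2 * c := by
  obtain ⟨g, a, hf, hg⟩ := exists_eq_add_X_pow_mul 0 1 f
  obtain ⟨g', b, hf', hg'⟩ := exists_eq_add_X_pow_mul 1 1 g
  obtain ⟨g'', c, hf'', hg''⟩ := exists_eq_add_X_pow_mul 2 1 g'
  have : g'' = C (constantCoeff f) := by
    ext n
    rw [hg'', hg', hg, coeff_C]
    have : n = 0 ↔ n 0 = 0 ∧ n 1 = 0 ∧ n 2 = 0 := by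
      rw [Finsupp.ext_iff, Fin.forall_fin_succ, Fin.forall_fin_succ, Fin.forall_fin_succ]
      simp
    by_cases h : n = 0
    · subst h; simp
    · rw [if_neg h]
      grind
  refine ⟨a, b, c, ?_⟩
  rw [← this, hf, hf', hf'']
  ring

/-- The coefficient of `x ^ a * y ^ b * z ^ c`. -/
noncomputable def coeff₃ (a b c : ℕ) : MvPowerSeries (Fin 3) k →ₗ[k] k :=
  coeff (Finsupp.single 0 a + Finsupp.single 1 b + Finsupp.single 2 c)

theorem coeff_X_mul' (n : σ →₀ ℕ) (s : σ) (f : MvPowerSeries σ k) :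
    coeff n (X s * f) = if n s = 0 then 0 else coeff (n - Finsupp.single s 1) f := by
  classical
  rw [X, coeff_monomial_mul, one_mul]
  simp only [Finsupp.single_le_iff, Nat.one_le_iff_ne_zero, ite_not]

@[simp]
theorem coeff₃_X_zero_mul (a b c : ℕ) (f : MvPowerSeries (Fin 3) k) :
    coeff₃ a b c (X 0 * f) = if a = 0 then 0 else coeff₃ (a - 1) b c f := by
  rw [coeff₃, coeff_X_mul', coeff₃]
  congr 3
  · simp
  · ext i; fin_cases i <;> simp

@[simp]
theorem coeff₃_X_one_mul (a b c : ℕ) (f : MvPowerSeries (Fin 3) k) :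
    coeff₃ a b c (X 1 * f) = if b = 0 then 0 else coeff₃ a (b - 1) c f := by
  rw [coeff₃, coeff_X_mul', coeff₃]
  congr 3
  · simp
  · ext i; fin_cases i <;> simp

@[simp]
theorem coeff₃_X_two_mul (a b c : ℕ) (f : MvPowerSeries (Fin 3) k) :
    coeff₃ a b c (X 2 * f) = if c = 0 then 0 else coeff₃ a b (c - 1) f := by
  rw [coeff₃, coeff_X_mul', coeff₃]
  congr 3
  · simp
  · ext i; fin_cases i <;> simp

theorem coeff₃_one (a b c : ℕ) :
    coeff₃ a b c (1 : MvPowerSeries (Fin 3) k) = if a = 0 ∧ b = 0 ∧ c = 0 then 1 else 0 := by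
  classical
  rw [coeff₃, coeff_one]
  congr 1
  rw [Finsupp.ext_iff, Fin.forall_fin_succ, Fin.forall_fin_succ, Fin.forall_fin_succ]
  simp

theorem coeff₃_zero_eq (f : MvPowerSeries (Fin 3) k) : coeff₃ 0 0 0 f = constantCoeff f := by
  simp [coeff₃]

end MvPowerSeries

/-! ### Simplified generators -/

open MvPowerSeries in
/-- A simplified system of generators of `idealI`. -/
noncomputable def simpleGenerators : Fin 5 → F2xyz :=
  ![X 0 ^ 2, X 0 * X 2 + X 1 ^ 2 * X 2, X 0 * X 1 + X 0 * X 2 + X 2 ^ 3,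
    X 1 ^ 3 + X 2 ^ 3 + X 1 ^ 2 * X 2 + X 1 ^ 2 * X 2 ^ 2, X 0 * X 1 ^ 2]

theorem two_eq_zero_F2xyz : (2 : F2xyz) = 0 := by
  have : (2 : ZMod 2) = 0 := by decide
  have h := congrArg (MvPowerSeries.C (σ := Fin 3)) this
  rwa [map_ofNat, map_zero] at h

theorem pfaffian_four {R : Type*} [CommRing R] (A : Matrix (Fin 4) (Fin 4) R) :
    pfaffian A = A 0 1 * A 2 3 - A 0 2 * A 1 3 + A 0 3 * A 1 2 := by
  simp [pfaffian, Fin.sum_univ_succ, Fin.succAbove]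
  ring

theorem submaximalPfaffian_matrixT (i : Fin 5) :
    let x : F2xyz := MvPowerSeries.X 0
    let y : F2xyz := MvPowerSeries.X 1
    let z : F2xyz := MvPowerSeries.X 2
    submaximalPfaffian matrixT i =
      ![x * x ^ 2 - (x + y + z) * (x + z) + (x + y + z + z ^ 2) * z,
        z * x ^ 2 - (z + y ^ 2) * (x + z) + z * z,
        (y + z) * x ^ 2 - (z + y ^ 2) * (x + y + z + z ^ 2) + z * (x + y + z),
        (y + z) * (x + z) - z * (x + y + z + z ^ 2) + z * x,
        (y + z) * z - z * (x + y + z) + (z + y ^ 2) * x] i := by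
  intro x y z
  rw [submaximalPfaffian, pfaffian_four]
  fin_cases i <;> rfl


theorem idealI_le_span_simpleGenerators :
    idealI ≤ Ideal.span (Set.range simpleGenerators) := by
  have h2 := two_eq_zero_F2xyz
  have hg (i) : simpleGenerators i ∈ Ideal.span (Set.range simpleGenerators) :=
    Ideal.subset_span ⟨i, rfl⟩
  rw [idealI, Ideal.span_le]
  rintro _ ⟨i, rfl⟩
  rw [SetLike.mem_coe, submaximalPfaffian_matrixT]
  generalize hJ : Ideal.span (Set.range simpleGenerators) = J at hg ⊢
  have h0 := hg 0
  have h1 := hg 1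
  have h3 := hg 2
  have h4 := hg 3
  have h5 := hg 4
  simp only [simpleGenerators, Matrix.cons_val] at h0 h1 h3 h4 h5
  generalize (MvPowerSeries.X 0 : F2xyz) = x at *
  generalize (MvPowerSeries.X 1 : F2xyz) = y at *
  generalize (MvPowerSeries.X 2 : F2xyz) = z at *
  fin_cases i
  · convert add_mem (J.mul_mem_left (1 + x) h0) h3 using 1
    simp; grind
  · convert add_mem (add_mem h1 (J.mul_mem_left z h0)) h5 using 1
    simp; grind
  · convert add_mem (add_mem (J.mul_mem_left (y + z) h0) h5) h4 using 1
    simp; grind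
  · convert h3 using 1
    simp; grind
  · convert h5 using 1
    simp; grind

theorem span_simpleGenerators_le_idealI :
    Ideal.span (Set.range simpleGenerators) ≤ idealI := by
  have h2 := two_eq_zero_F2xyz
  have hp (i) : submaximalPfaffian matrixT i ∈ idealI := Ideal.subset_span ⟨i, rfl⟩
  generalize idealI = J at hp ⊢
  simp only [submaximalPfaffian_matrixT] at hp
  have hu : IsUnit (1 + MvPowerSeries.X 0 : F2xyz) := by
    rw [MvPowerSeries.isUnit_iff_constantCoeff]
    simp
  rw [Ideal.span_le]
  rintro _ ⟨i, rfl⟩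
  have p1 := hp 0
  have p2 := hp 1
  have p3 := hp 2
  have p4 := hp 3
  have p5 := hp 4
  simp only [simpleGenerators, Matrix.cons_val, SetLike.mem_coe] at p1 p2 p3 p4 p5 ⊢
  generalize (MvPowerSeries.X 0 : F2xyz) = x at *
  generalize (MvPowerSeries.X 1 : F2xyz) = y at *
  generalize (MvPowerSeries.X 2 : F2xyz) = z at *
  -- In characteristic two the difference of these pfaffians is `(1 + x) * x ^ 2`, and `1 + x` is a
  -- unit in the power series ring.
  have g1 : x ^ 2 ∈ J := by
    rw [← Ideal.unit_mul_mem_iff_mem J hu]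
    convert sub_mem p1 p4 using 1
    grind
  have g5 : x * y ^ 2 ∈ J := by
    convert p5 using 1
    grind
  fin_cases i
  · exact g1
  · convert sub_mem (sub_mem p2 (J.mul_mem_left z g1)) g5 using 1
    simp; grind
  · convert p4 using 1
    simp; grind
  · convert sub_mem (sub_mem p3 (J.mul_mem_left (y + z) g1)) g5 using 1
    simp; grind
  · exact g5

theorem idealI_eq_span_simpleGenerators :
    idealI = Ideal.span (Set.range simpleGenerators) :=
  le_antisymm idealI_le_span_simpleGenerators span_simpleGenerators_le_idealI

/-! ### The dual form -/

open MvPowerSeries in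
/-- The linear form given by a dual socle generator of `idealI`. -/
noncomputable def dualForm : F2xyz →ₗ[ZMod 2] ZMod 2 :=
  coeff₃ 0 0 5 + coeff₃ 0 4 0 + coeff₃ 0 3 2 + coeff₃ 0 1 4 + coeff₃ 1 1 2

theorem dualForm_eq_zero_of_mem {r : F2xyz} (hr : r ∈ idealI) : dualForm r = 0 := by
  rw [idealI_eq_span_simpleGenerators] at hr
  refine Ideal.map_eq_zero_of_mem_span dualForm ?_ hr
  rintro _ ⟨i, rfl⟩ a
  fin_cases i <;>
    simp [simpleGenerators, dualForm, mul_comm a, add_mul, pow_succ, mul_assoc]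
  -- The surviving coefficients of `a` cancel in pairs in characteristic two.
  all_goals
    generalize MvPowerSeries.coeff₃ 0 0 2 a = p
    generalize MvPowerSeries.coeff₃ 0 1 0 a = q
    generalize MvPowerSeries.coeff₃ 0 1 1 a = r
    decide +revert

/-! ### Minimal number of generators -/

open MvPowerSeries in
/-- Linear forms on `idealI` that separate the simplified generators modulo the maximal ideal. -/
noncomputable def generatorForms : F2xyz →ₗ[ZMod 2] (Fin 5 → ZMod 2) :=
  LinearMap.pi ![coeff₃ 2 0 0, coeff₃ 1 0 1 + coeff₃ 1 1 0, coeff₃ 1 1 0, coeff₃ 0 3 0,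
    coeff₃ 1 2 0 + coeff₃ 0 1 3 + coeff₃ 1 1 2 + coeff₃ 0 0 5 + coeff₃ 0 1 4 + coeff₃ 0 3 2]

theorem generatorForms_simpleGenerators (i : Fin 5) :
    generatorForms (simpleGenerators i) = Pi.single i 1 := by
  -- The trailing factor `1` lets the shift lemmas strip every variable, ending at `coeff₃_one`.
  rw [← mul_one (simpleGenerators i)]
  ext j
  fin_cases i <;> fin_cases j <;>
    simp [simpleGenerators, generatorForms, add_mul, pow_succ, mul_assoc,
    MvPowerSeries.coeff₃_one, -mul_one]
  rfl

open MvPowerSeries in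
theorem generatorForms_mul {r : F2xyz} (hr : r ∈ idealI) (a : F2xyz) :
    generatorForms (a * r) = constantCoeff a • generatorForms r := by
  rw [idealI_eq_span_simpleGenerators] at hr
  refine Ideal.map_mul_eq_smul_of_mem_span constantCoeff generatorForms ?_ hr a
  rintro _ ⟨i, rfl⟩ a
  rw [generatorForms_simpleGenerators]
  ext j
  fin_cases i <;> fin_cases j <;>
    simp [simpleGenerators, generatorForms, mul_comm a, add_mul, pow_succ, mul_assoc, coeff₃_zero_eq]
  all_goals
    generalize MvPowerSeries.coeff₃ 0 0 2 a = p
    generalize MvPowerSeries.coeff₃ 0 1 0 a = q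
    generalize MvPowerSeries.coeff₃ 0 1 1 a = r
    generalize constantCoeff a = t
    decide +revert

theorem spanRank_idealI : Submodule.spanRank idealI = 5 := by
  apply le_antisymm
  · refine (Submodule.spanRank_span_le_card _).trans ?_
    simpa using Cardinal.mk_range_le (f := submaximalPfaffian matrixT)
  · have h := Ideal.rank_le_spanRank_of_character MvPowerSeries.constantCoeff idealI
      generatorForms (fun r hr a => generatorForms_mul hr a) ?_
    · simpa using h
    · rw [eq_top_iff]
      rintro v -
      refine ⟨∑ i, v i • simpleGenerators i, ?_, ?_⟩
      · refine sum_mem fun i _ => Submodule.smul_mem _ _ ?_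
        rw [idealI_eq_span_simpleGenerators]
        exact Ideal.subset_span ⟨i, rfl⟩
      · simp only [map_sum, map_smul, generatorForms_simpleGenerators]
        exact (pi_eq_sum_univ' v).symm

/-! ### A monomial spanning set of the quotient -/

/-- Consequences of the vanishing of the simplified generators in characteristic two. -/
theorem simpleGenerators_relations {A : Type*} [CommRing A] {x y z : A} (h2 : (2 : A) = 0)
    (g2 : x * z + y ^ 2 * z = 0) (g3 : x * y + x * z + z ^ 3 = 0)
    (g4 : y ^ 3 + z ^ 3 + y ^ 2 * z + y ^ 2 * z ^ 2 = 0) (g5 : x * y ^ 2 = 0) :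
    (x * z = y ^ 2 * z ∧ x * y = y ^ 2 * z + z ^ 3 ∧
      y ^ 3 = z ^ 3 + y ^ 2 * z + y ^ 2 * z ^ 2) ∧
    (x * z ^ 3 = 0 ∧ y ^ 2 * z ^ 3 = 0 ∧ z ^ 6 = 0) ∧
    (y ^ 3 * z = y ^ 2 * z ^ 2 + z ^ 4 ∧ y * z ^ 3 = y ^ 2 * z ^ 2 + z ^ 4) ∧
    (y ^ 3 * z ^ 2 = z ^ 5 ∧ y * z ^ 4 = z ^ 5) := by
  have r1 : x * z = y ^ 2 * z := by grind
  have r2 : x * y = y ^ 2 * z + z ^ 3 := by grind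
  have r3 : y ^ 3 = z ^ 3 + y ^ 2 * z + y ^ 2 * z ^ 2 := by grind
  -- `y ^ 2 * g3` with `g5` gives `e2`, and then `r1` gives `e1`. Computing `x * y * z` in two ways
  -- gives `e3`; finally `z ^ 6 = y ^ 3 * z ^ 3 = 0` by `e5` and `e2`.
  have e1 : x * z ^ 3 = 0 := by grind
  have e2 : y ^ 2 * z ^ 3 = 0 := by grind
  have e3 : y ^ 3 * z = y ^ 2 * z ^ 2 + z ^ 4 := by grind
  have e4 : y * z ^ 3 = y ^ 2 * z ^ 2 + z ^ 4 := by grind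
  have e5 : y ^ 3 * z ^ 2 = z ^ 5 := by grind
  have e6 : y * z ^ 4 = z ^ 5 := by grind
  have e7 : z ^ 6 = 0 := by grind
  exact ⟨⟨r1, r2, r3⟩, ⟨e1, e2, e7⟩, ⟨e3, e4⟩, e5, e6⟩

open MvPowerSeries in
/-- Monomials that form a basis of the quotient by `idealI`. -/
noncomputable def standardMonomials : Fin 13 → F2xyz :=
  ![1, X 0, X 1, X 2, X 1 ^ 2, X 1 * X 2, X 2 ^ 2, X 1 ^ 2 * X 2, X 1 * X 2 ^ 2, X 2 ^ 3,
    X 1 ^ 2 * X 2 ^ 2, X 2 ^ 4, X 2 ^ 5]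

/-- The power series all of whose multiples lie in a given subspace are tested on the variables. -/
theorem MvPowerSeries.mul_mem_of_X_mul {k A : Type*} [CommRing k] [CommRing A] [Algebra k A]
    (π : MvPowerSeries (Fin 3) k →ₐ[k] A) (W : Submodule k A) (μ : A) (hμ : μ ∈ W)
    (h0 : ∀ f, π f * (π (X 0) * μ) ∈ W) (h1 : ∀ f, π f * (π (X 1) * μ) ∈ W)
    (h2 : ∀ f, π f * (π (X 2) * μ) ∈ W) (f : MvPowerSeries (Fin 3) k) : π f * μ ∈ W := by
  obtain ⟨a, b, c, hf⟩ := exists_eq_C_add_X_mul f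
  have hC : π (C (constantCoeff f)) * μ = constantCoeff f • μ := by
    rw [Algebra.smul_def, ← π.commutes]
    rfl
  have : π f * μ = constantCoeff f • μ + π a * (π (X 0) * μ) + π b * (π (X 1) * μ) +
      π c * (π (X 2) * μ) := by
    rw [← hC]
    conv_lhs => rw [hf]
    simp only [map_add, map_mul]
    ring
  rw [this]
  exact add_mem (add_mem (add_mem (W.smul_mem _ hμ) (h0 a)) (h1 b)) (h2 c)

theorem span_standardMonomials :
    Submodule.span (ZMod 2) (Set.range fun i =>
      Ideal.Quotient.mkₐ (ZMod 2) idealI (standardMonomials i)) = ⊤ := by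
  generalize hW : Submodule.span (ZMod 2) (Set.range fun i =>
      Ideal.Quotient.mkₐ (ZMod 2) idealI (standardMonomials i)) = W
  have hb (i) : Ideal.Quotient.mkₐ (ZMod 2) idealI (standardMonomials i) ∈ W :=
    hW ▸ Submodule.subset_span ⟨i, rfl⟩
  have hg (i) : Ideal.Quotient.mkₐ (ZMod 2) idealI (simpleGenerators i) = 0 := by
    refine Ideal.Quotient.eq_zero_iff_mem.2 ?_
    rw [idealI_eq_span_simpleGenerators]
    exact Ideal.subset_span ⟨i, rfl⟩
  have h2 := congrArg (Ideal.Quotient.mkₐ (ZMod 2) idealI) two_eq_zero_F2xyz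
  have step := MvPowerSeries.mul_mem_of_X_mul (Ideal.Quotient.mkₐ (ZMod 2) idealI) W
  suffices ∀ f, Ideal.Quotient.mkₐ (ZMod 2) idealI f * 1 ∈ W by
    rw [eq_top_iff]
    rintro a -
    obtain ⟨f, rfl⟩ := Ideal.Quotient.mkₐ_surjective (ZMod 2) idealI a
    simpa using this f
  clear hW
  generalize Ideal.Quotient.mkₐ (ZMod 2) idealI = π at *
  have g1 := hg 0
  have g2 := hg 1
  have g3 := hg 2
  have g4 := hg 3
  have g5 := hg 4
  have b0 := hb 0
  have b1 := hb 1
  have b2 := hb 2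
  have b3 := hb 3
  have b4 := hb 4
  have b5 := hb 5
  have b6 := hb 6
  have b7 := hb 7
  have b8 := hb 8
  have b9 := hb 9
  have b10 := hb 10
  have b11 := hb 11
  have b12 := hb 12
  simp only [simpleGenerators, standardMonomials, Matrix.cons_val, map_add, map_mul, map_pow,
    map_one, map_ofNat, map_zero] at g1 g2 g3 g4 g5 b0 b1 b2 b3 b4 b5 b6 b7 b8 b9 b10 b11 b12 h2
  generalize π (MvPowerSeries.X 0) = x at *
  generalize π (MvPowerSeries.X 1) = y at *
  generalize π (MvPowerSeries.X 2) = z at *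
  obtain ⟨⟨r1, r2, r3⟩, ⟨e1, e2, e7⟩, ⟨e3, e4⟩, e5, e6⟩ :=
    simpleGenerators_relations h2 g2 g3 g4 g5
  have zero {μ} (h : μ = 0) : ∀ f, π f * μ ∈ W := fun f => by rw [h, mul_zero]; exact zero_mem _
  have add {μ ν ρ} (hν : ∀ f, π f * ν ∈ W) (hρ : ∀ f, π f * ρ ∈ W) (h : μ = ν + ρ) :
      ∀ f, π f * μ ∈ W := fun f => by rw [h, mul_add]; exact add_mem (hν f) (hρ f)
  have eq {μ ν} (hν : ∀ f, π f * ν ∈ W) (h : μ = ν) : ∀ f, π f * μ ∈ W := h ▸ hν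
  -- Descending from `z ^ 5`, which all variables kill, to `1`: each `p` puts every multiple of one
  -- standard monomial in `W`, using the monomials already treated.
  have p12 := step _ b12 (zero (by linear_combination z ^ 2 * e1))
    (zero (by linear_combination z * e6 + e7)) (zero (by linear_combination e7))
  have p11 := step _ b11 (zero (by linear_combination z * e1)) (eq p12 (by linear_combination e6))
    (eq p12 (by ring))
  have p10 := step _ b10 (zero (by linear_combination z ^ 2 * g5))
    (eq p12 (by linear_combination e5)) (zero (by linear_combination e2))
  have p9 := step _ b9 (zero e1) (add p10 p11 e4) (eq p11 (by ring))
  have p8 := step _ b8 (eq p12 (by linear_combination y * z * r1 + e5))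
    (eq p10 (by ring)) (add p10 p11 (by linear_combination e4))
  have p7 := step _ b7 (zero (by linear_combination z * g5))
    (add p10 p11 (by linear_combination e3)) (eq p10 (by ring))
  have p6 := step _ b6 (eq p10 (by linear_combination z * r1)) (eq p8 rfl) (eq p9 (by ring))
  have p5 := step _ b5 (add p10 p11 (by linear_combination y * r1 + e3)) (eq p7 (by ring))
    (eq p8 (by ring))
  have p4 := step _ b4 (zero g5) (add (add p9 p7 rfl) p10 (by linear_combination r3))
    (eq p7 (by ring))
  have p3 := step _ b3 (eq p7 r1) (eq p5 rfl) (eq p6 (by ring))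
  have p2 := step _ b2 (add p7 p9 r2) (eq p4 (by ring)) (eq p5 (by ring))
  have p1 := step _ b1 (zero (by linear_combination g1))
    (add p7 p9 (by linear_combination r2)) (eq p7 (by linear_combination r1))
  exact step _ b0 (eq p1 (mul_one _)) (eq p2 (mul_one _)) (eq p3 (mul_one _))

/-! ### Duality and the Gorenstein property -/

/-- Modulo `I`, `r` is a combination of standard monomials; pairing it with these 13 monomials
forces all coefficients to vanish. -/
theorem mem_idealI_of_dualForm {r : F2xyz} (h : ∀ a, dualForm (a * r) = 0) : r ∈ idealI := by
  have hr : Ideal.Quotient.mkₐ (ZMod 2) idealI r ∈ (⊤ : Submodule (ZMod 2) _) := trivial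
  rw [← span_standardMonomials, Submodule.mem_span_range_iff_exists_fun] at hr
  obtain ⟨c, hc⟩ := hr
  have hs : ∑ i, c i • standardMonomials i - r ∈ idealI := by
    rw [← Ideal.Quotient.eq_zero_iff_mem]
    rw [map_sub, sub_eq_zero, map_sum]
    exact hc
  have hd (j) : dualForm (standardMonomials j * ∑ i, c i • standardMonomials i) = 0 := by
    have := dualForm_eq_zero_of_mem (idealI.mul_mem_left (standardMonomials j) hs)
    rwa [mul_sub, map_sub, h, sub_zero] at this
  have : c = 0 := by
    obtain ⟨S, hS⟩ : ∃ S, S = ∑ i, c i • standardMonomials i := ⟨_, rfl⟩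
    have cS (i j k : ℕ) : MvPowerSeries.coeff₃ i j k S =
        ∑ n, c n * MvPowerSeries.coeff₃ i j k (standardMonomials n * 1) := by
      simp [hS]
    rw [← hS] at hd
    have d0 := hd 0
    have d1 := hd 1
    have d2 := hd 2
    have d3 := hd 3
    have d4 := hd 4
    have d5 := hd 5
    have d6 := hd 6
    have d7 := hd 7
    have d8 := hd 8
    have d9 := hd 9
    have d10 := hd 10
    have d11 := hd 11
    have d12 := hd 12
    simp only [standardMonomials, Matrix.cons_val, dualForm, pow_succ, pow_zero, one_mul,
      mul_assoc, LinearMap.add_apply, MvPowerSeries.coeff₃_X_zero_mul,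
      MvPowerSeries.coeff₃_X_one_mul, MvPowerSeries.coeff₃_X_two_mul]
      at d0 d1 d2 d3 d4 d5 d6 d7 d8 d9 d10 d11 d12
    simp [cS, Fin.sum_univ_succ, standardMonomials, pow_succ, mul_assoc, -mul_one,
      MvPowerSeries.coeff₃_one] at d0 d1 d2 d3 d4 d5 d6 d7 d8 d9 d10 d11 d12
    simp only [mul_one] at d2 d4 d5 d6 d8 d9 d11
    -- Back substitution: the equations become triangular after reordering.
    rw [d3, add_zero] at d2
    rw [d1, add_zero] at d4 d6
    rw [d6, add_zero] at d5
    rw [d7, add_zero] at d9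
    rw [d4, d9, zero_add, zero_add] at d8
    rw [d10, add_zero] at d11
    ext i
    fin_cases i <;> assumption
  simpa [this] using hs

theorem mem_idealI_iff {r : F2xyz} : r ∈ idealI ↔ ∀ a, dualForm (a * r) = 0 :=
  ⟨fun hr a => dualForm_eq_zero_of_mem (idealI.mul_mem_left a hr), mem_idealI_of_dualForm⟩

theorem one_notMem_idealI : (1 : F2xyz) ∉ idealI := by
  rw [mem_idealI_iff]
  intro h
  -- `y ^ 4` is a monomial on which `dualForm` is 1.
  have := h (MvPowerSeries.X 1 ^ 4)
  rw [mul_one, ← mul_one (_ ^ 4)] at this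
  simp [dualForm, pow_succ, mul_assoc, -mul_one, MvPowerSeries.coeff₃_one] at this

instance finite_quotient_idealI : Module.Finite (ZMod 2) (F2xyz ⧸ idealI) :=
  ⟨span_standardMonomials ▸ Submodule.fg_span (Set.finite_range _)⟩

/-- The linear form induced by `dualForm` on the quotient by `idealI`. -/
noncomputable def quotientDualForm : F2xyz ⧸ idealI →ₗ[ZMod 2] ZMod 2 :=
  (idealI.restrictScalars (ZMod 2)).liftQ dualForm (fun _ hr => dualForm_eq_zero_of_mem hr) ∘ₗ
    (Submodule.Quotient.restrictScalarsEquiv (ZMod 2) idealI).symm.toLinearMap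

theorem quotientDualForm_mk (r : F2xyz) :
    quotientDualForm (Ideal.Quotient.mk idealI r) = dualForm r := rfl

theorem baer_quotient_idealI : Module.Baer (F2xyz ⧸ idealI) (F2xyz ⧸ idealI) := by
  refine Module.Baer.of_linearForm quotientDualForm fun a h => ?_
  obtain ⟨r, rfl⟩ := Ideal.Quotient.mk_surjective a
  rw [Ideal.Quotient.eq_zero_iff_mem, mem_idealI_iff]
  intro b
  rw [← quotientDualForm_mk, map_mul]
  exact h _

theorem isGorensteinIdeal_idealI : IsGorensteinIdeal idealI where
  isNoetherianRing := inferInstance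
  isLocalRing :=
    have : Nontrivial (F2xyz ⧸ idealI) :=
      Ideal.Quotient.nontrivial_iff.2 ((Ideal.ne_top_iff_one _).2 one_notMem_idealI)
    IsLocalRing.of_surjective' (Ideal.Quotient.mk idealI) Ideal.Quotient.mk_surjective
  finite_injectiveDimension := by
    have := baer_quotient_idealI.injective
    have : CategoryTheory.Injective (ModuleCat.of (F2xyz ⧸ idealI) (F2xyz ⧸ idealI)) :=
      Module.injective_object_of_injective_module _ _
    exact ⟨0, inferInstance⟩

/-! ### Grade -/

open RingTheory.Sequence IsLocalRing

namespace MvPowerSeries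

/-- Krull's height theorem: three variables generate the maximal ideal. -/
theorem ringKrullDim_fin_three_le (k : Type*) [Field k] :
    ringKrullDim (MvPowerSeries (Fin 3) k) ≤ 3 := by
  have hspan : maximalIdeal (MvPowerSeries (Fin 3) k) ≤ Ideal.span (Set.range X) := by
    intro f hf
    obtain ⟨a, b, c, h⟩ := exists_eq_C_add_X_mul f
    have h0 : constantCoeff f = 0 := by
      rw [mem_maximalIdeal, mem_nonunits_iff, isUnit_iff_constantCoeff, isUnit_iff_ne_zero,
        not_not] at hf
      exact hf
    rw [h, h0, map_zero, zero_add]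
    have hX (i) : X i ∈ Ideal.span (Set.range (X (R := k) (σ := Fin 3))) :=
      Ideal.subset_span ⟨i, rfl⟩
    exact add_mem (add_mem (Ideal.mul_mem_right _ _ (hX 0)) (Ideal.mul_mem_right _ _ (hX 1)))
      (Ideal.mul_mem_right _ _ (hX 2))
  have heq : maximalIdeal (MvPowerSeries (Fin 3) k) = Ideal.span (Set.range X) := by
    refine le_antisymm hspan (Ideal.span_le.2 ?_)
    rintro _ ⟨i, rfl⟩
    simp [isUnit_iff_constantCoeff]
  rw [← maximalIdeal_height_eq_ringKrullDim]
  have h1 := Ideal.height_le_spanFinrank (maximalIdeal (MvPowerSeries (Fin 3) k))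
    (maximalIdeal.isMaximal _).ne_top
  have h2 : (maximalIdeal (MvPowerSeries (Fin 3) k)).spanFinrank ≤ 3 := by
    rw [heq]
    refine (Submodule.spanFinrank_span_le_ncard_of_finite (Set.finite_range _)).trans ?_
    rw [← Set.image_univ]
    refine (Set.ncard_image_le Set.finite_univ).trans ?_
    simp [Set.ncard_univ]
  have h3 : (maximalIdeal (MvPowerSeries (Fin 3) k)).height ≤ (3 : ℕ) :=
    h1.trans (by exact_mod_cast h2)
  exact WithBot.coe_le_coe.2 h3

theorem coeff_X_pow_mul_eq_zero {σ k : Type*} [CommRing k] {s : σ} {m : ℕ} (f : MvPowerSeries σ k)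
    {n : σ →₀ ℕ} (hn : n s < m) : coeff n (X s ^ m * f) = 0 :=
  X_pow_dvd_iff.1 (dvd_mul_right _ f) n hn

theorem mem_span_pair_X_pow_iff {σ k : Type*} [CommRing k] {s t : σ} {l m : ℕ}
    {f : MvPowerSeries σ k} :
    f ∈ Ideal.span {X s ^ l, X t ^ m} ↔ ∀ n : σ →₀ ℕ, n s < l → n t < m → coeff n f = 0 := by
  rw [Ideal.mem_span_pair]
  constructor
  · rintro ⟨a, b, rfl⟩ n hs ht
    rw [map_add, mul_comm a, mul_comm b, coeff_X_pow_mul_eq_zero _ hs,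
      coeff_X_pow_mul_eq_zero _ ht, add_zero]
  · intro h
    obtain ⟨g, a, hf, hg⟩ := exists_eq_add_X_pow_mul s l f
    obtain ⟨b, hb⟩ : X t ^ m ∣ g := by
      rw [X_pow_dvd_iff]
      intro n hn
      rw [hg]
      split_ifs with hs
      · exact h n hs hn
      · rfl
    exact ⟨a, b, by rw [hf, hb]; ring⟩

theorem coeff_add_single_X_pow_mul {σ k : Type*} [CommRing k] (s : σ) (m : ℕ) (n : σ →₀ ℕ)
    (f : MvPowerSeries σ k) : coeff (n + Finsupp.single s m) (X s ^ m * f) = coeff n f := by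
  rw [X_pow_eq, add_comm, coeff_add_monomial_mul, one_mul]

/-- Powers of three distinct variables form a weakly regular sequence. -/
theorem isWeaklyRegular_X_pow {σ k : Type*} [CommRing k] {s t u : σ} (hst : s ≠ t) (hsu : s ≠ u)
    (htu : t ≠ u) (l m p : ℕ) :
    IsWeaklyRegular (MvPowerSeries σ k) [X s ^ l, X t ^ m, (X u ^ p : MvPowerSeries σ k)] := by
  refine ⟨fun i hi => ?_⟩
  rw [isSMulRegular_on_quot_iff_lsmul_comap_le]
  intro f hf
  rw [Submodule.mem_comap, LinearMap.lsmul_apply] at hf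
  simp only [smul_eq_mul, Ideal.mul_top] at hf ⊢
  simp only [List.length_cons, List.length_nil] at hi
  -- Membership in the ideal of the earlier powers is a vanishing condition on coefficients, and
  -- multiplying by the next power shifts only the exponent of another variable.
  match i, hi with
  | 0, _ =>
    simp only [List.take_zero, Ideal.ofList_nil, Ideal.mem_bot, List.getElem_cons_zero] at hf ⊢
    ext n
    rw [← coeff_add_single_X_pow_mul s l, hf, map_zero, map_zero]
  | 1, _ =>
    simp only [List.take_succ_cons, List.take_zero, Ideal.ofList_singleton,
      List.getElem_cons_succ, List.getElem_cons_zero, Ideal.mem_span_singleton,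
      X_pow_dvd_iff] at hf ⊢
    intro n hn
    rw [← coeff_add_single_X_pow_mul t m]
    exact hf _ (by simpa [hst] using hn)
  | 2, _ =>
    have h : Ideal.ofList [X s ^ l, (X t ^ m : MvPowerSeries σ k)] =
        Ideal.span {X s ^ l, X t ^ m} := by
      rw [Ideal.ofList_cons, Ideal.ofList_singleton, Ideal.span_insert]
    simp only [List.take_succ_cons, List.take_zero, List.getElem_cons_succ,
      List.getElem_cons_zero, h, mem_span_pair_X_pow_iff] at hf ⊢
    intro n hn hn'
    rw [← coeff_add_single_X_pow_mul u p]
    exact hf _ (by simpa [hsu] using hn) (by simpa [htu] using hn')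

end MvPowerSeries

/-- Each term of a regular sequence lowers the dimension by one, and the final quotient is nonzero.
-/
theorem idealGrade_le_of_ringKrullDim_le {R : Type*} [CommRing R] [IsNoetherianRing R]
    [IsLocalRing R] {I : Ideal R} (hI : I ≠ ⊤) {d : ℕ} (hd : ringKrullDim R ≤ d) :
    idealGrade I ≤ d := by
  refine iSup_le fun rs => iSup_le fun hrs => iSup_le fun hreg => ?_
  have hreg' : IsRegular R rs := IsRegular.of_isWeaklyRegular_of_mem_maximalIdeal _
    (fun r hr => le_maximalIdeal hI (hrs r hr)) hreg
  have h := ringKrullDim_add_length_eq_ringKrullDim_of_isRegular rs hreg'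
  have : Nontrivial (R ⧸ Ideal.ofList rs) := by
    refine Ideal.Quotient.nontrivial_iff.2 fun h => hreg'.2 ?_
    simp [h]
  have h0 := ringKrullDim_nonneg_of_nontrivial (R := R ⧸ Ideal.ofList rs)
  have h1 : (rs.length : WithBot ℕ∞) ≤ d := by
    refine le_trans ?_ hd
    rw [← h]
    exact le_add_of_nonneg_left h0
  exact_mod_cast h1

/-- Each exponent exceeds that of its variable in every monomial of `dualForm`. -/
theorem X_pow_mem_idealI :
    (MvPowerSeries.X 0 ^ 2 : F2xyz) ∈ idealI ∧ (MvPowerSeries.X 1 ^ 6 : F2xyz) ∈ idealI ∧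
      (MvPowerSeries.X 2 ^ 6 : F2xyz) ∈ idealI := by
  simp only [mem_idealI_iff]
  refine ⟨?_, ?_, ?_⟩ <;> intro a <;> simp [dualForm, mul_comm a, pow_succ, mul_assoc]

theorem idealGrade_idealI : idealGrade idealI = 3 := by
  apply le_antisymm
  · exact idealGrade_le_of_ringKrullDim_le ((Ideal.ne_top_iff_one _).2 one_notMem_idealI)
      (MvPowerSeries.ringKrullDim_fin_three_le (ZMod 2))
  · obtain ⟨hx, hy, hz⟩ := X_pow_mem_idealI
    refine le_iSup_of_le [MvPowerSeries.X 0 ^ 2, MvPowerSeries.X 1 ^ 6, MvPowerSeries.X 2 ^ 6] ?_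
    refine le_iSup_of_le (by simp [hx, hy, hz]) ?_
    refine le_iSup_of_le (MvPowerSeries.isWeaklyRegular_X_pow (by decide) (by decide)
      (by decide) 2 6 6) ?_
    simp

theorem mainTheorem4 :
    IsGorensteinIdeal idealI ∧ idealGrade idealI = 3 ∧ Submodule.spanRank idealI = 5 :=
  ⟨isGorensteinIdeal_idealI, idealGrade_idealI, spanRank_idealI⟩
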